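/- Let $p_n$ denote the $n$-th prime number, so that $p_1 = 2$, $p_2 = 3$, $p_3 = 5$, and so on. Then for every integer $n \geq 9$, $$p_{n+2}^3 < p_{n+1}^3 + p_n^3.$$ -/

import Mathlib

/-- The `n`-th prime number `p_n`, counted from `p_1 = 2`, for `n ≥ 1`.
Mathlib's `Nat.nth` counts from `0`, hence the shift. -/
noncomputable def nthPrime (n : ℕ) : ℕ := Nat.nth Nat.Prime (n - 1)

/-! Two primes `p < q` above `x` with `q ≤ 5x/4` give `q³ < 2x³`, because `(5/4)³ < 2`; applied to
`x = pₙ` this bounds `pₙ₊₂³` by `2pₙ³ < pₙ₊₁³ + pₙ³`. The two primes exist as soon as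
`θ (5x/4) - θ x > log (5x/4)`.

Bertrand-type estimates are too weak for the factor `5/4`, but Chebyshev's are not: his ratio
`⌊x⌋! ⌊x/30⌋! / (⌊x/2⌋! ⌊x/3⌋! ⌊x/5⌋!)` has logarithm `C x + O(log x)`, lies between
`exp (ψ x - ψ (x/6))` and `exp (ψ x)`, and so confines `ψ x / x` asymptotically to `[C, 6C/5]`,
where `6/5 < 5/4`. This settles `x ≥ 180000`; a chain of explicit primes, each less than `2^(1/3)`
times the one two places before it, covers `37 ≤ x < 180000`. -/

open Finset Real Chebyshev
open scoped Nat ArithmeticFunction.vonMangoldt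

section LogFactorial

lemma sub_mul_log_le_mul_log_sub_self_sub {a b : ℝ} (ha : 0 < a) (hb : 0 < b) :
    (b - a) * log a ≤ (b * log b - b) - (a * log a - a) := by
  have h : b * (1 - a / b) ≤ b * (log b - log a) := by
    rw [← log_div hb.ne' ha.ne', ← inv_div b a]
    exact mul_le_mul_of_nonneg_left (one_sub_inv_le_log_of_pos (div_pos hb ha)) hb.le
  rw [mul_sub, mul_one, mul_div_cancel₀ _ hb.ne'] at h
  linarith

lemma mul_log_sub_self_le_log_factorial (n : ℕ) : n * log n - n ≤ log n ! := by
  have hpos : (0 : ℝ) < n ^ n := mod_cast n.pow_self_pos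
  have h := log_le_log (by positivity) (pow_div_factorial_le_exp (n : ℝ) n.cast_nonneg n)
  rw [log_exp, log_div hpos.ne' (by positivity), log_pow] at h
  linarith

lemma log_factorial_le {n : ℕ} (hn : n ≠ 0) : log n ! ≤ n * log n - n + log n / 2 + 1 := by
  obtain ⟨m, rfl⟩ := Nat.exists_eq_succ_of_ne_zero hn
  have hm : ((m.succ : ℕ) : ℝ) ≠ 0 := by positivity
  have h : log (Stirling.stirlingSeq m.succ) ≤ log (Stirling.stirlingSeq 1) :=
    Stirling.log_stirlingSeq'_antitone m.zero_le
  rw [Stirling.log_stirlingSeq_formula, Stirling.stirlingSeq_one, log_mul two_ne_zero hm,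
    log_div hm (exp_pos 1).ne', log_div (exp_pos 1).ne' (by positivity), log_sqrt zero_le_two,
    log_exp] at h
  linarith

lemma abs_log_factorial_floor_sub_le {x : ℝ} (hx : 1 ≤ x) :
    |log (⌊x⌋₊ !) - (x * log x - x)| ≤ log x + 1 := by
  set n := ⌊x⌋₊
  have hn : 1 ≤ n := (Nat.one_le_floor_iff x).2 hx
  have hn₁ : (1 : ℝ) ≤ n := by exact_mod_cast hn
  have hx₀ : 0 < x := by linarith
  have hn₀ : (0 : ℝ) < n := by linarith
  have hnx : (n : ℝ) ≤ x := Nat.floor_le hx₀.le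
  have hxn : x < n + 1 := Nat.lt_floor_add_one x
  have hlog : log n ≤ log x := log_le_log hn₀ hnx
  rw [abs_le]
  constructor
  · have htangent := sub_mul_log_le_mul_log_sub_self_sub hx₀ hn₀
    have hgap : (x - n) * log x ≤ 1 * log x :=
      mul_le_mul_of_nonneg_right (by linarith) (log_nonneg hx)
    linarith [mul_log_sub_self_le_log_factorial n]
  · have htangent := sub_mul_log_le_mul_log_sub_self_sub hn₀ hx₀
    have hgap : 0 ≤ (x - n) * log n := mul_nonneg (by linarith) (log_nonneg hn₁)
    linarith [log_factorial_le (Nat.one_le_iff_ne_zero.1 hn), log_nonneg hn₁]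

lemma log_factorial_eq_sum_log (n : ℕ) : log n ! = ∑ k ∈ Ioc 0 n, log k := by
  induction n with
  | zero => simp
  | succ n ih =>
    rw [sum_Ioc_succ_top n.zero_le, ← ih, Nat.factorial_succ, Nat.cast_mul,
      log_mul (by positivity) (by positivity), add_comm]

lemma log_factorial_eq_sum_vonMangoldt (n : ℕ) :
    log n ! = ∑ d ∈ Ioc 0 n, Λ d * (n / d : ℕ) := by
  rw [← ArithmeticFunction.sum_Ioc_mul_zeta_eq_sum, ArithmeticFunction.vonMangoldt_mul_zeta,
    log_factorial_eq_sum_log]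
  rfl

lemma log_factorial_div_eq_sum_vonMangoldt (n k : ℕ) :
    log ((n / k)!) = ∑ d ∈ Ioc 0 n, Λ d * (n / d / k : ℕ) := by
  simp only [log_factorial_eq_sum_vonMangoldt, Nat.div_right_comm n k]
  refine sum_subset (Ioc_subset_Ioc_right (Nat.div_le_self n k)) fun d hd hd' => ?_
  have hlt : n / k < d := by
    simp only [mem_Ioc] at hd hd'
    omega
  rw [Nat.div_right_comm, Nat.div_eq_of_lt hlt, Nat.cast_zero, mul_zero]

end LogFactorial

section ChebyshevRatio

/-- The logarithm of Chebyshev's factorial ratio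
`⌊x⌋! ⌊x/30⌋! / (⌊x/2⌋! ⌊x/3⌋! ⌊x/5⌋!)`, the quantity through which `ψ` is estimated. -/
noncomputable def logChebyshevRatio (x : ℝ) : ℝ :=
  log (⌊x⌋₊ !) - log (⌊x / 2⌋₊ !) - log (⌊x / 3⌋₊ !) - log (⌊x / 5⌋₊ !) + log (⌊x / 30⌋₊ !)

/-- The coefficient of `Λ d` in `logChebyshevRatio x`, as a function of `m = ⌊x / d⌋`. The
divisions are those of `ℕ`, the subtractions those of `ℤ`. -/
def chebyshevCoeff (m : ℕ) : ℤ :=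
  m - (m / 2 : ℕ) - (m / 3 : ℕ) - (m / 5 : ℕ) + (m / 30 : ℕ)

lemma chebyshevCoeff_nonneg (m : ℕ) : 0 ≤ chebyshevCoeff m := by
  unfold chebyshevCoeff
  omega

lemma chebyshevCoeff_le_one (m : ℕ) : chebyshevCoeff m ≤ 1 := by
  unfold chebyshevCoeff
  omega

lemma chebyshevCoeff_eq_one {m : ℕ} (hm : 1 ≤ m) (hm' : m < 6) : chebyshevCoeff m = 1 := by
  unfold chebyshevCoeff
  omega

lemma logChebyshevRatio_eq_sum (x : ℝ) :
    logChebyshevRatio x = ∑ d ∈ Ioc 0 ⌊x⌋₊, Λ d * chebyshevCoeff (⌊x⌋₊ / d) := by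
  simp only [logChebyshevRatio, chebyshevCoeff, Nat.floor_div_ofNat,
    log_factorial_div_eq_sum_vonMangoldt, log_factorial_eq_sum_vonMangoldt ⌊x⌋₊,
    ← sum_sub_distrib, ← sum_add_distrib, ← mul_sub, ← mul_add]
  push_cast
  rfl

lemma logChebyshevRatio_le_psi (x : ℝ) : logChebyshevRatio x ≤ ψ x := by
  rw [logChebyshevRatio_eq_sum, psi]
  exact sum_le_sum fun d _ => mul_le_of_le_one_right ArithmeticFunction.vonMangoldt_nonneg
    (mod_cast chebyshevCoeff_le_one _)

lemma psi_sub_psi_div_six_le (x : ℝ) : ψ x - ψ (x / 6) ≤ logChebyshevRatio x := by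
  have hsub : Ioc 0 ⌊x / 6⌋₊ ⊆ Ioc 0 ⌊x⌋₊ :=
    Ioc_subset_Ioc_right (Nat.floor_div_ofNat x 6 ▸ Nat.div_le_self _ _)
  rw [logChebyshevRatio_eq_sum, psi, psi, ← sum_sdiff hsub, add_sub_cancel_right, ← sum_sdiff hsub]
  refine le_add_of_le_of_nonneg (sum_le_sum fun d hd => ?_) (sum_nonneg fun d _ => ?_)
  · simp only [Nat.floor_div_ofNat, mem_sdiff, mem_Ioc, not_and, not_le] at hd
    obtain ⟨⟨hd₀, hdx⟩, hd6⟩ := hd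
    have hlt : ⌊x⌋₊ / d < 6 := by
      have := hd6 hd₀
      rw [Nat.div_lt_iff_lt_mul hd₀]
      omega
    rw [chebyshevCoeff_eq_one ((Nat.one_le_div_iff hd₀).2 hdx) hlt, Int.cast_one, mul_one]
  · exact mul_nonneg ArithmeticFunction.vonMangoldt_nonneg (mod_cast chebyshevCoeff_nonneg _)

/-- Chebyshev's constant `0.92129…`, the linear growth rate of `logChebyshevRatio`. -/
noncomputable def chebyshevConst : ℝ := log 2 / 2 + log 3 / 3 + log 5 / 5 - log 30 / 30

lemma lt_chebyshevConst : 0.921 < chebyshevConst := by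
  have h30 : log 30 = log 2 + log 3 + log 5 := by
    rw [← log_mul (by norm_num) (by norm_num), ← log_mul (by norm_num) (by norm_num)]
    norm_num
  unfold chebyshevConst
  linarith [log_two_gt_d9, log_three_gt_d9, log_five_gt_d9]

lemma abs_log_factorial_floor_div_sub_le {x k : ℝ} (hk : 1 ≤ k) (hkx : k ≤ x) :
    |log (⌊x / k⌋₊ !) - (x / k * (log x - log k) - x / k)| ≤ log x + 1 := by
  have hk₀ : 0 < k := by linarith
  have h := abs_log_factorial_floor_sub_le ((one_le_div hk₀).2 hkx)
  rw [log_div (by linarith) hk₀.ne'] at h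
  linarith [log_nonneg hk]

-- The terms in `x * log x` and `x` cancel because `1 - 1/2 - 1/3 - 1/5 + 1/30 = 0`.
lemma abs_logChebyshevRatio_sub_le {x : ℝ} (hx : 30 ≤ x) :
    |logChebyshevRatio x - chebyshevConst * x| ≤ 5 * log x + 5 := by
  have h1 := abs_le.1 (abs_log_factorial_floor_sub_le (x := x) (by linarith))
  have h2 := abs_le.1 (abs_log_factorial_floor_div_sub_le (x := x) (k := 2) (by simp) (by linarith))
  have h3 := abs_le.1 (abs_log_factorial_floor_div_sub_le (x := x) (k := 3) (by simp) (by linarith))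
  have h5 := abs_le.1 (abs_log_factorial_floor_div_sub_le (x := x) (k := 5) (by simp) (by linarith))
  have h30 := abs_le.1 (abs_log_factorial_floor_div_sub_le (x := x) (k := 30) (by simp) hx)
  unfold logChebyshevRatio chebyshevConst
  rw [abs_le]
  constructor <;> linarith

end ChebyshevRatio

section PsiTheta

lemma chebyshevConst_mul_sub_le_psi {x : ℝ} (hx : 30 ≤ x) :
    chebyshevConst * x - (5 * log x + 5) ≤ ψ x := by
  linarith [(abs_le.1 (abs_logChebyshevRatio_sub_le hx)).1, logChebyshevRatio_le_psi x]

lemma psi_le_psi_div_six_add {x : ℝ} (hx : 30 ≤ x) :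
    ψ x ≤ ψ (x / 6) + chebyshevConst * x + (5 * log x + 5) := by
  linarith [(abs_le.1 (abs_logChebyshevRatio_sub_le hx)).2, psi_sub_psi_div_six_le x]

lemma psi_le_psi_div_six_pow_add {x : ℝ} {k : ℕ} (hx : 5 * 6 ^ k ≤ x) :
    ψ x ≤ ψ (x / 6 ^ k) + 6 / 5 * chebyshevConst * (x - x / 6 ^ k) + k * (5 * log x + 5) := by
  induction k with
  | zero => simp
  | succ k ih =>
    have hpow : (1 : ℝ) ≤ 6 ^ k := one_le_pow₀ (by norm_num)
    rw [pow_succ] at hx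
    have hx₀ : 0 < x := by linarith
    have hstep := psi_le_psi_div_six_add (x := x / 6 ^ k)
      ((le_div_iff₀ (by positivity)).2 (by linarith))
    have hlog : log (x / 6 ^ k) ≤ log x :=
      log_le_log (by positivity) (div_le_self hx₀.le hpow)
    rw [pow_succ, ← div_div]
    push_cast
    linarith [ih (by linarith)]

lemma psi_sub_theta_le_const_mul_sqrt (x : ℝ) : ψ x - θ x ≤ 3 * (log 4 + 4) * √x := by
  rcases le_total x 1 with hx | hx
  · rw [psi_eq_zero_of_le_one hx, theta_eq_zero_of_le_one hx, sub_zero]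
    positivity
  · have hroot : ∀ r : ℝ, r ≤ 1 / 2 → ψ (x ^ r) ≤ ψ (√x) := fun r hr =>
      psi_mono (sqrt_eq_rpow x ▸ rpow_le_rpow_of_exponent_le hx hr)
    linarith [psi_sub_theta_le_psi_add_psi_add_psi x, hroot 2⁻¹ (by norm_num),
      hroot 3⁻¹ (by norm_num), hroot 5⁻¹ (by norm_num), psi_le_const_mul_self (sqrt_nonneg x)]

lemma log_four_add_four_lt : log 4 + 4 < 5.4 := by
  rw [show (4 : ℝ) = 2 ^ 2 by norm_num, log_pow, Nat.cast_ofNat]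
  linarith [log_two_lt_d9]

-- Tangent line of `log` at `√x = 512`, near the point where the error terms are absorbed.
lemma log_le_sqrt_div_add {x : ℝ} (hx : 0 < x) : log x ≤ √x / 256 + 10.5 := by
  have htangent := log_le_sub_one_of_pos (show 0 < √x / 2 ^ 9 by positivity)
  rw [log_div (by positivity) (by positivity), log_sqrt hx.le, log_pow, Nat.cast_ofNat] at htangent
  linarith [log_two_lt_d9]

lemma chebyshev_error_lt {x : ℝ} (hx : 225000 ≤ x) :
    16.2 * √x + 31 * log x + 30 < 0.0362 * x := by
  have hsq : √x ^ 2 = x := sq_sqrt (by linarith)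
  have hroot : 474 ≤ √x := le_sqrt_of_sq_le (by linarith)
  nlinarith [log_le_sqrt_div_add (x := x) (by linarith)]

lemma log_lt_theta_sub_theta {x : ℝ} (hx : 180000 ≤ x) :
    log (5 / 4 * x) < θ (5 / 4 * x) - θ x := by
  have hlower := chebyshevConst_mul_sub_le_psi (x := 5 / 4 * x) (by linarith)
  have hupper := psi_le_psi_div_six_pow_add (x := x) (k := 5) (by linarith)
  have htail := psi_le_const_mul_self (x := x / 6 ^ 5) (by positivity)
  have hroot := psi_sub_theta_le_const_mul_sqrt (5 / 4 * x)
  have herror := chebyshev_error_lt (x := 5 / 4 * x) (by linarith)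
  have hlog : log x ≤ log (5 / 4 * x) := log_le_log (by linarith) (by linarith)
  have htail' : (log 4 + 4) * (x / 6 ^ 5) ≤ 5.4 * (x / 6 ^ 5) := by
    gcongr
    exact log_four_add_four_lt.le
  have hroot' : 3 * (log 4 + 4) * √(5 / 4 * x) ≤ 16.2 * √(5 / 4 * x) := by
    gcongr
    linarith [log_four_add_four_lt]
  have hconst : 0.921 * x ≤ chebyshevConst * x := by
    gcongr
    exact lt_chebyshevConst.le
  push_cast at hupper
  linarith [theta_le_psi x]

lemma exists_two_primes_of_log_lt_theta_sub {x y : ℝ} (hy : 1 ≤ y) (h : log y < θ y - θ x) :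
    ∃ p q : ℕ, p.Prime ∧ q.Prime ∧ x < p ∧ p < q ∧ q ≤ y := by
  have hxy : x ≤ y := (theta_mono.reflect_lt (by linarith [log_nonneg hy])).le
  have hsub : {p ∈ Ioc 0 ⌊x⌋₊ | p.Prime} ⊆ {p ∈ Ioc 0 ⌊y⌋₊ | p.Prime} :=
    filter_subset_filter _ (Ioc_subset_Ioc_right (Nat.floor_mono hxy))
  set s := {p ∈ Ioc 0 ⌊y⌋₊ | p.Prime} \ {p ∈ Ioc 0 ⌊x⌋₊ | p.Prime}
  have hs : ∀ p ∈ s, p.Prime ∧ x < p ∧ p ≤ y := by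
    intro p hp
    simp only [s, mem_sdiff, mem_filter, mem_Ioc] at hp
    exact ⟨hp.1.2, Nat.lt_of_floor_lt (by grind),
      (Nat.le_floor_iff (by linarith)).1 hp.1.1.2⟩
  have hsum : θ y - θ x = ∑ p ∈ s, log p := by
    rw [theta, theta, ← sum_sdiff hsub, add_sub_cancel_right]
  have hle : ∑ p ∈ s, log p ≤ #s * log y := by
    rw [← nsmul_eq_mul]
    exact sum_le_card_nsmul _ _ _ fun p hp =>
      log_le_log (mod_cast (hs p hp).1.pos) (hs p hp).2.2
  have hcard : 1 < #s := by
    by_contra! hc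
    have hc' : (#s : ℝ) ≤ 1 := mod_cast hc
    linarith [mul_le_mul_of_nonneg_right hc' (log_nonneg hy)]
  obtain ⟨p, hp, q, hq, hpq⟩ := one_lt_card.1 hcard
  obtain ⟨hp', hxp, hpy⟩ := hs p hp
  obtain ⟨hq', hxq, hqy⟩ := hs q hq
  rcases hpq.lt_or_gt with hlt | hgt
  · exact ⟨p, q, hp', hq', hxp, hlt, hqy⟩
  · exact ⟨q, p, hq', hp', hxq, hgt, hpy⟩

end PsiTheta

section PrimePairs

/-- Two primes above `n` whose cubes are less than `2 * n ^ 3`: the property that, at a prime `n`,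
controls the second prime after it. -/
def HasCubePrimePairAbove (n : ℕ) : Prop :=
  ∃ p q : ℕ, p.Prime ∧ q.Prime ∧ n < p ∧ p < q ∧ q ^ 3 < 2 * n ^ 3

lemma hasCubePrimePairAbove_of_large {n : ℕ} (hn : 180000 ≤ n) : HasCubePrimePairAbove n := by
  have hn' : (180000 : ℝ) ≤ n := mod_cast hn
  obtain ⟨p, q, hp, hq, hnp, hpq, hqn⟩ :=
    exists_two_primes_of_log_lt_theta_sub (by linarith) (log_lt_theta_sub_theta hn')
  refine ⟨p, q, hp, hq, mod_cast hnp, hpq, ?_⟩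
  have hcube : (q : ℝ) ^ 3 < 2 * n ^ 3 := calc
    (q : ℝ) ^ 3 ≤ (5 / 4 * (n : ℝ)) ^ 3 := by gcongr
    _ = 125 / 64 * (n : ℝ) ^ 3 := by ring
    _ < 2 * (n : ℝ) ^ 3 := by gcongr; norm_num
  exact_mod_cast hcube

/-- In the list, every entry `c` has cube less than `2 * a ^ 3`, where `a` is the entry two places
before it, and the last entry but one is at least `N`. A list of primes with this property
witnesses `HasCubePrimePairAbove n` for all `n` from its first entry up to `N`. -/
def IsCubeChain (N : ℕ) : List ℕ → Prop
  | a :: b :: c :: l => b < c ∧ c ^ 3 < 2 * a ^ 3 ∧ IsCubeChain N (b :: c :: l)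
  | a :: _ => N ≤ a
  | [] => False

lemma IsCubeChain.hasCubePrimePairAbove {N n : ℕ} (hn : n < N) :
    ∀ {a : ℕ} {l : List ℕ}, IsCubeChain N (a :: l) → (∀ p ∈ a :: l, p.Prime) → a ≤ n →
      HasCubePrimePairAbove n
  | a, b :: c :: l, ⟨hbc, hac, hchain⟩, hprime, han => by
    rcases le_or_gt b n with hbn | hnb
    · exact hchain.hasCubePrimePairAbove hn (fun p hp => hprime p (.tail a hp)) hbn
    · exact ⟨b, c, hprime b (by simp), hprime c (by simp), hnb, hbc, hac.trans_le (by gcongr)⟩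
  | _, [], hNa, _, han => absurd (han.trans_lt hn) (not_lt.2 hNa)
  | _, [_], hNa, _, han => absurd (han.trans_lt hn) (not_lt.2 hNa)

/-- The primes that settle `37 ≤ n < 180000`. Each entry after `37, 41` is the largest
prime in `(b, 2 ^ (1 / 6) * b]`, where `b` is the entry before it, or the next prime after `b` if
there is none. -/
def cubeChain : List ℕ :=
  [37, 41, 43, 47, 53, 59, 61, 67, 73, 79, 83, 89, 97, 107, 113, 127, 139, 151, 167, 181,
    199, 223, 241, 269, 293, 317, 353, 389, 433, 479, 523, 587, 653, 727, 811, 907, 1013,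
    1129, 1259, 1409, 1579, 1759, 1973, 2213, 2477, 2777, 3109, 3469, 3889, 4363, 4889,
    5483, 6151, 6899, 7741, 8681, 9743, 10909, 12241, 13729, 15401, 17257, 19333, 21683,
    24337, 27299, 30637, 34381, 38569, 43291, 48589, 54539, 61211, 68699, 77101, 86539,
    97127, 109013, 122347, 137321, 154127, 172999, 194179, 217937]

lemma prime_of_mem_cubeChain : ∀ p ∈ cubeChain, p.Prime := by
  norm_num [cubeChain]

lemma isCubeChain_cubeChain : IsCubeChain 180000 cubeChain := by
  norm_num [cubeChain, IsCubeChain]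

lemma hasCubePrimePairAbove {n : ℕ} (hn : 37 ≤ n) : HasCubePrimePairAbove n := by
  rcases lt_or_ge n 180000 with hlt | hge
  · exact isCubeChain_cubeChain.hasCubePrimePairAbove hlt prime_of_mem_cubeChain hn
  · exact hasCubePrimePairAbove_of_large hge

end PrimePairs

section NthPrime

lemma nthPrime_mono : Monotone nthPrime := fun _ _ h =>
  Nat.nth_monotone Nat.infinite_setOfPred_prime (Nat.sub_le_sub_right h 1)

lemma nthPrime_succ_le {n p : ℕ} (hp : p.Prime) (h : nthPrime n < p) : nthPrime (n + 1) ≤ p := by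
  cases n with
  | zero => exact h.le
  | succ n => exact not_lt.1 fun hlt => h.not_ge (Nat.le_nth_of_lt_nth_succ hlt hp)

lemma nthPrime_count_add_one {p : ℕ} (hp : p.Prime) : nthPrime (Nat.count Nat.Prime p + 1) = p :=
  Nat.nth_count hp

lemma nthPrime_nine_to_thirteen : nthPrime 9 = 23 ∧ nthPrime 10 = 29 ∧ nthPrime 11 = 31 ∧
    nthPrime 12 = 37 ∧ nthPrime 13 = 41 := by
  exact ⟨nthPrime_count_add_one (p := 23) (by norm_num),
    nthPrime_count_add_one (p := 29) (by norm_num), nthPrime_count_add_one (p := 31) (by norm_num),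
    nthPrime_count_add_one (p := 37) (by norm_num), nthPrime_count_add_one (p := 41) (by norm_num)⟩

lemma nthPrime_add_two_pow_three_lt {n : ℕ} (hn : 12 ≤ n) :
    nthPrime (n + 2) ^ 3 < 2 * nthPrime n ^ 3 := by
  have h37 : 37 ≤ nthPrime n := nthPrime_nine_to_thirteen.2.2.2.1 ▸ nthPrime_mono hn
  obtain ⟨p, q, hp, hq, hnp, hpq, hq3⟩ := hasCubePrimePairAbove h37
  have hle_p : nthPrime (n + 1) ≤ p := nthPrime_succ_le hp hnp
  have hle_q : nthPrime (n + 2) ≤ q := nthPrime_succ_le hq (hle_p.trans_lt hpq)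
  exact (Nat.pow_le_pow_left hle_q 3).trans_lt hq3

end NthPrime

theorem theorem3 (n : ℕ) (hn : 9 ≤ n) :
    nthPrime (n + 2) ^ 3 < nthPrime (n + 1) ^ 3 + nthPrime n ^ 3 := by
  rcases lt_or_ge n 12 with hlt | hge
  · obtain ⟨h9, h10, h11, h12, h13⟩ := nthPrime_nine_to_thirteen
    interval_cases n <;> simp only [h9, h10, h11, h12, h13] <;> norm_num
  · calc
      nthPrime (n + 2) ^ 3 < nthPrime n ^ 3 + nthPrime n ^ 3 := by
        rw [← two_mul]
        exact nthPrime_add_two_pow_three_lt hge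
      _ ≤ nthPrime (n + 1) ^ 3 + nthPrime n ^ 3 := by
        gcongr
        exact nthPrime_mono n.le_succ
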